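/- Call a group $G$ \emph{capable} if there is a group $K$ with $G\cong K/Z(K)$, and, for a prime $p$, call a finite group an \emph{extra-special} $p$-group if its center has order $p$ and its central quotient is a nontrivial elementary abelian $p$-group. Let $p$ be an odd prime and let $G$ be a group of nilpotency class two and exponent $p$. Assume that $G^{\mathrm{ab}}=G/[G,G]$ has rank $4$ and that $[G,G]$ has rank $1$ (the rank of a finitely generated group being its minimal number of generators, so that $|G^{\mathrm{ab}}|=p^4$ and $|[G,G]|=p$). Then $G$ is capable if and only if $Z(G)/[G,G]$ is nontrivial; that is, $G$ is capable if and only if $G$ is not an extra-special $p$-group. -/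

import Mathlib

universe u

/-- A group is capable if it is isomorphic to the central quotient `K / Z(K)` of some group `K`.
Taking `K` in the universe of `G` loses nothing: if `K / Z(K)` is isomorphic to `G`, then a
subgroup of `K` generated by lifts of the elements of `G` has the same central quotient. -/
def IsCapable (G : Type u) [Group G] : Prop :=
  ∃ (K : Type u) (_ : Group K), Nonempty (G ≃* K ⧸ Subgroup.center K)

/-- A finite group is an extra-special `p`-group if its center has order `p` and its central
quotient is a nontrivial elementary abelian `p`-group. -/
structure IsExtraSpecial (p : ℕ) (G : Type u) [Group G] : Prop where
  finite : Finite G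
  card_center : Nat.card (Subgroup.center G) = p
  nontrivial_quotient : Nontrivial (G ⧸ Subgroup.center G)
  comm_quotient : ∀ x y : G ⧸ Subgroup.center G, x * y = y * x
  pow_quotient : ∀ x : G ⧸ Subgroup.center G, x ^ p = 1

/-! Here `G` has order `p ^ 5` and a central derived subgroup `C` of order `p`, so `G` is
extra-special exactly when `C = Z(G)`.

If `C = Z(G)`, every centralizer is nonabelian: for the commutator form on the 4-dimensional `G/C`,
the orthogonal complement of a vector has dimension at least 3, too large to be isotropic. Now let
`G ≅ K/Z(K)` and `t` in `K`. Lift a noncommuting pair from the centralizer of the image of `t`; the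
commutator of the lifts commutes with `t` and its image generates `C`. Hence every lift of an
element of `C` commutes with every `t`, so it lies in `Z(K)` and `C` is trivial, a contradiction.

If `C < Z(G)`, the form has rank 2 and `G` is the Heisenberg group mod `p` times two factors of
order `p`. `CoverGroup` is a class-three group with central quotient the Heisenberg group, times a
Heisenberg group with central quotient of order `p ^ 2`; this realizes `G` as a central quotient. -/

open Subgroup
open scoped commutatorElement

/-! ### Order and rank of elementary abelian groups -/

section Elementary

/-- A finitely generated abelian group of prime exponent `p` has order `p ^ rank`. -/
theorem card_eq_pow_rank_of_elementary {p : ℕ} (hp : p.Prime) (A : Type*) [CommGroup A]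
    [Group.FG A] (hpow : ∀ x : A, x ^ p = 1) : Nat.card A = p ^ Group.rank A := by
  classical
  have : Fact p.Prime := ⟨hp⟩
  have hdvd := card_dvd_exponent_pow_rank' A hpow
  have hle : Nat.card A ≤ p ^ Group.rank A := Nat.le_of_dvd (pow_pos hp.pos _) hdvd
  have hpos : Nat.card A ≠ 0 := fun h => by
    rw [h, zero_dvd_iff] at hdvd
    exact (pow_pos hp.pos _).ne' hdvd
  have : Finite A := Nat.finite_of_card_ne_zero hpos
  obtain ⟨_⟩ : Nonempty (Module (ZMod p) (Additive A)) :=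
    ⟨AddCommGroup.zmodModule fun x => hpow x.toMul⟩
  let b := Module.finBasis (ZMod p) (Additive A)
  have hcard : Nat.card A = p ^ Module.finrank (ZMod p) (Additive A) := by
    have := Module.natCard_eq_pow_finrank (K := ZMod p) (V := Additive A)
    rwa [Nat.card_zmod] at this
  let S : Finset A := Finset.univ.image fun i => (b i).toMul
  have hS : closure (S : Set A) = ⊤ := by
    -- Every subgroup is a `ZMod p`-subspace, so a basis also generates the group, bounding the rank
    -- by the dimension.
    have h1 : Submodule.span (ZMod p) (Set.range b) ≤
        AddSubgroup.toZModSubmodule p (Subgroup.toAddSubgroup (closure (S : Set A))) := by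
      rw [Submodule.span_le]
      rintro _ ⟨i, rfl⟩
      change (b i).toMul ∈ closure (S : Set A)
      exact subset_closure (Finset.mem_coe.2 (Finset.mem_image_of_mem _ (Finset.mem_univ i)))
    rw [b.span_eq] at h1
    exact eq_top_iff.2 fun x _ => h1 (x := Additive.ofMul x) trivial
  have hr : Group.rank A ≤ Module.finrank (ZMod p) (Additive A) :=
    (Group.rank_le hS).trans (Finset.card_image_le.trans (by simp))
  rw [hcard] at hle ⊢
  have := (Nat.pow_le_pow_iff_right hp.one_lt).1 hle
  rw [le_antisymm hr this]

end Elementary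

/-! ### Centralizers as kernels of commutator maps -/

section CommutatorMaps

variable {G : Type*} [Group G]

/-- In a group whose derived subgroup is central, commutation with a fixed element is a
homomorphism. -/
def commutatorHom (h : commutator G ≤ center G) (y : G) : G →* G where
  toFun g := ⁅g, y⁆
  map_one' := commutatorElement_one_left y
  map_mul' a b := by
    have hb : ⁅b, y⁆ ∈ center G :=
      h (commutator_mem_commutator (mem_top b) (mem_top y))
    have : a * ⁅b, y⁆ = ⁅b, y⁆ * a := mem_center_iff.1 hb a
    calc ⁅a * b, y⁆ = a * ⁅b, y⁆ * (y * a⁻¹ * y⁻¹) := by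
          simp only [commutatorElement_def]; group
      _ = ⁅b, y⁆ * ⁅a, y⁆ := by
          rw [this]; simp only [commutatorElement_def]; group
      _ = ⁅a, y⁆ * ⁅b, y⁆ := (mem_center_iff.1 hb _).symm

theorem mem_ker_commutatorHom (h : commutator G ≤ center G) {y g : G} :
    g ∈ (commutatorHom h y).ker ↔ Commute g y :=
  MonoidHom.mem_ker.trans commutatorElement_eq_one_iff_commute

theorem range_commutatorHom_le (h : commutator G ≤ center G) (y : G) :
    (commutatorHom h y).range ≤ commutator G := by
  rintro _ ⟨g, rfl⟩
  exact commutator_mem_commutator (mem_top g) (mem_top y)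

theorem card_le_card_ker_commutatorHom_mul [Finite G] (h : commutator G ≤ center G) (y : G) :
    Nat.card G ≤ Nat.card (commutatorHom h y).ker * Nat.card (commutator G) := by
  rw [← card_mul_index (commutatorHom h y).ker, index_ker]
  exact Nat.mul_le_mul_left _ (card_le_of_le (range_commutatorHom_le h y))

/-- The joint centralizer of `x` and `y` is the kernel of `g ↦ (⁅g, x⁆, ⁅g, y⁆)`, whose image lies
in the square of the derived subgroup. -/
theorem card_le_card_ker_inf_ker_mul [Finite G] (h : commutator G ≤ center G) (x y : G) :
    Nat.card G ≤ Nat.card ((commutatorHom h x).ker ⊓ (commutatorHom h y).ker : Subgroup G) *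
      Nat.card (commutator G) ^ 2 := by
  have hk : (commutatorHom h x).ker ⊓ (commutatorHom h y).ker =
      ((commutatorHom h x).prod (commutatorHom h y)).ker := by
    ext g; simp [MonoidHom.mem_ker, Prod.ext_iff]
  rw [hk, ← card_mul_index ((commutatorHom h x).prod (commutatorHom h y)).ker, index_ker]
  refine Nat.mul_le_mul_left _ ?_
  have hr : ((commutatorHom h x).prod (commutatorHom h y)).range ≤
      (commutator G).prod (commutator G) := by
    rintro _ ⟨g, rfl⟩
    exact ⟨range_commutatorHom_le h x ⟨g, rfl⟩, range_commutatorHom_le h y ⟨g, rfl⟩⟩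
  refine (card_le_of_le hr).trans (le_of_eq ?_)
  rw [Nat.card_congr ((commutator G).prodEquiv (commutator G)).toEquiv, Nat.card_prod, sq]

end CommutatorMaps

/-! ### Extra-special groups are not capable -/

section NotCapable

variable {G : Type*} [Group G]

/-- If `a` and `b` commute with `t` modulo the center, their commutator commutes with `t`. -/
theorem commute_commutatorElement_of_mem_center {K : Type*} [Group K] {a b t : K}
    (ha : ⁅t, a⁆ ∈ center K) (hb : ⁅t, b⁆ ∈ center K) : Commute t ⁅a, b⁆ := by
  obtain ⟨u, hu⟩ : ∃ u, u = ⁅t, a⁆ := ⟨_, rfl⟩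
  obtain ⟨v, hv⟩ : ∃ v, v = ⁅t, b⁆ := ⟨_, rfl⟩
  have h1 : t * a * t⁻¹ = u * a := by rw [hu, commutatorElement_def]; group
  have h2 : t * b * t⁻¹ = v * b := by rw [hv, commutatorElement_def]; group
  rw [← hu] at ha
  rw [← hv] at hb
  have cu : ∀ g, g * u = u * g := mem_center_iff.1 ha
  have cv : ∀ g, g * v = v * g := mem_center_iff.1 hb
  -- Conjugation by `t` multiplies `a` and `b` by central elements, which cancel in the commutator.
  have h3 : t * ⁅a, b⁆ * t⁻¹ = ⁅a, b⁆ := by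
    calc t * ⁅a, b⁆ * t⁻¹ = ⁅t * a * t⁻¹, t * b * t⁻¹⁆ := by
          simp only [commutatorElement_def]; group
      _ = ⁅u * a, v * b⁆ := by rw [h1, h2]
      _ = u * (a * v) * b * a⁻¹ * u⁻¹ * b⁻¹ * v⁻¹ := by
          simp only [commutatorElement_def]; group
      _ = (u * v) * (a * b * a⁻¹) * u⁻¹ * b⁻¹ * v⁻¹ := by rw [cv]; group
      _ = (a * b * a⁻¹) * (u * v) * u⁻¹ * b⁻¹ * v⁻¹ := by
          rw [← mem_center_iff.1 (mul_mem ha hb) (a * b * a⁻¹)]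
      _ = (a * b * a⁻¹) * (v * u) * u⁻¹ * b⁻¹ * v⁻¹ := by rw [cu v]
      _ = (a * b * a⁻¹) * (v * b⁻¹) * v⁻¹ := by group
      _ = (a * b * a⁻¹) * (b⁻¹ * v) * v⁻¹ := by rw [cv]
      _ = ⁅a, b⁆ := by rw [commutatorElement_def]; group
  exact mul_inv_eq_iff_eq_mul.1 h3

/-- A group with derived subgroup of prime order, in which the centralizer of each element is
nonabelian, is not capable. -/
theorem not_isCapable_of_centralizers_nonabelian {G : Type u} [Group G] {p : ℕ} (hp : p.Prime)
    (hC : Nat.card (commutator G) = p)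
    (hx : ∀ x : G, ∃ a b : G, Commute x a ∧ Commute x b ∧ ¬ Commute a b) :
    ¬ IsCapable G := by
  rintro ⟨K, _, ⟨e⟩⟩
  have : Fact p.Prime := ⟨hp⟩
  let f : K →* G := e.symm.toMonoidHom.comp (QuotientGroup.mk' (center K))
  have hf : Function.Surjective f :=
    e.symm.surjective.comp (QuotientGroup.mk'_surjective _)
  have hker : ∀ k, f k = 1 ↔ k ∈ center K := fun k => by
    simp [f, QuotientGroup.eq_one_iff]
  have hcomm : ∀ {s t : K}, Commute (f s) (f t) → ⁅s, t⁆ ∈ center K := fun {s t} h => by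
    rw [← hker, map_commutatorElement]
    exact commutatorElement_eq_one_iff_commute.2 h
  -- The choice `x = 1` only supplies a nontrivial commutator; its lift `k` will turn out central.
  obtain ⟨a₀, b₀, -, -, h₀⟩ := hx 1
  obtain ⟨k, hk⟩ := hf ⁅a₀, b₀⁆
  have hmem : ∀ a b : G, ⁅a, b⁆ ∈ commutator G := fun a b =>
    commutator_mem_commutator (mem_top a) (mem_top b)
  refine h₀ (commutatorElement_eq_one_iff_commute.1 ?_)
  rw [← hk, hker, mem_center_iff]
  intro t
  obtain ⟨a, b, ha, hb, hab⟩ := hx (f t)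
  obtain ⟨a', rfl⟩ := hf a
  obtain ⟨b', rfl⟩ := hf b
  have ht : Commute t ⁅a', b'⁆ := commute_commutatorElement_of_mem_center (hcomm ha) (hcomm hb)
  have hne : (⟨⁅f a', f b'⁆, hmem _ _⟩ : commutator G) ≠ 1 := fun h =>
    hab (commutatorElement_eq_one_iff_commute.1 (congrArg Subtype.val h))
  obtain ⟨n, hn⟩ := mem_zpowers_iff.1
    (mem_zpowers_of_prime_card hC (g' := ⟨⁅a₀, b₀⁆, hmem _ _⟩) hne)
  have hn' : ⁅f a', f b'⁆ ^ n = ⁅a₀, b₀⁆ := by simpa using congrArg Subtype.val hn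
  have hz : k * (⁅a', b'⁆ ^ n)⁻¹ ∈ center K := by
    rw [← hker, map_mul, map_inv, map_zpow, map_commutatorElement, hk, hn', mul_inv_cancel]
  have hkt : Commute t (k * (⁅a', b'⁆ ^ n)⁻¹ * ⁅a', b'⁆ ^ n) :=
    Commute.mul_right (mem_center_iff.1 hz t) (ht.zpow_right n)
  rwa [inv_mul_cancel_right] at hkt

/-- Centralizers of elements are nonabelian when the order is `p ^ 5` and both the center and the
derived subgroup have order `p`. -/
theorem exists_noncommuting_in_centralizer {p : ℕ} (hp : p.Prime)
    (hG : Nat.card G = p ^ 5) (hle : commutator G ≤ center G)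
    (hC : Nat.card (commutator G) = p) (hZ : Nat.card (center G) = p) (x : G) :
    ∃ a b : G, Commute x a ∧ Commute x b ∧ ¬ Commute a b := by
  have : Finite G := Nat.finite_of_card_ne_zero (by rw [hG]; exact (pow_pos hp.pos _).ne')
  by_contra! hcon
  set A := (commutatorHom hle x).ker with hA
  have memA : ∀ {g}, g ∈ A ↔ Commute g x := mem_ker_commutatorHom hle
  have habel : ∀ a ∈ A, ∀ b ∈ A, Commute a b := fun a ha b hb =>
    hcon a b (memA.1 ha).symm (memA.1 hb).symm
  have hAcard : p ^ 4 ≤ Nat.card A := by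
    have := card_le_card_ker_commutatorHom_mul hle x
    rw [hG, hC, pow_succ] at this
    exact Nat.le_of_mul_le_mul_right this hp.pos
  have key : ∀ g, p ^ 3 ≤ Nat.card (A ⊓ (commutatorHom hle g).ker : Subgroup G) := fun g => by
    have := card_le_card_ker_inf_ker_mul hle x g
    rw [hG, hC, show 5 = 3 + 2 from rfl, pow_add] at this
    exact Nat.le_of_mul_le_mul_right this (pow_pos hp.pos 2)
  -- The index of `A` is at most `p`, so nothing lies strictly between `A` and `G`.
  have htop : ∀ H : Subgroup G, A < H → H = ⊤ := fun H hAH => by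
    obtain ⟨k, hk, hHk⟩ := (Nat.dvd_prime_pow hp).1 (hG ▸ card_subgroup_dvd_card H)
    have hlt : Nat.card A < Nat.card H := by
      refine lt_of_le_of_ne (card_le_of_le hAH.le) fun h => hAH.ne ?_
      exact eq_of_le_of_card_ge hAH.le h.ge
    have : 4 < k := (Nat.pow_lt_pow_iff_right hp.one_lt).1 (hHk ▸ hAcard.trans_lt hlt)
    refine eq_top_of_card_eq H ?_
    rw [hHk, hG, show k = 5 by omega]
  -- For `g ∉ A`, an element of the abelian `A` commuting with `g` has centralizer strictly above
  -- `A`, hence is central. This puts at least `p ^ 3` elements in a center of order `p`.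
  have hsub : ∃ g, (A ⊓ (commutatorHom hle g).ker : Subgroup G) ≤ center G := by
    by_cases hAt : A = ⊤
    · refine ⟨1, fun a _ => mem_center_iff.2 fun b => ?_⟩
      exact habel b (hAt ▸ mem_top b) a (hAt ▸ mem_top a)
    · obtain ⟨g, hg⟩ : ∃ g, g ∉ A := by
        by_contra! h
        exact hAt (eq_top_iff.2 fun g _ => h g)
      refine ⟨g, fun a ha => ?_⟩
      have h1 : A < (commutatorHom hle a).ker := by
        refine lt_of_le_of_ne (fun b hb => (mem_ker_commutatorHom hle).2 (habel b hb a ha.1)) ?_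
        intro h
        exact hg (h ▸ (mem_ker_commutatorHom hle).2 ((mem_ker_commutatorHom hle).1 ha.2).symm)
      refine mem_center_iff.2 fun b => (mem_ker_commutatorHom hle).1 ?_
      rw [htop _ h1]
      exact mem_top b
  obtain ⟨g, hg⟩ := hsub
  have h := (key g).trans (card_le_of_le hg)
  rw [hZ] at h
  have h13 : p ^ 1 < p ^ 3 := Nat.pow_lt_pow_right hp.one_lt (by norm_num)
  rw [pow_one] at h13
  omega

end NotCapable

/-! ### The covering group and its center -/

section Cover

/-- The product of the group `R³ ⋊ R` of nilpotency class three, in which `a ∈ R` acts on `R³` by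
`(b, c, d) ↦ (b, c + a b, d + 2 a c + a² b)`, and the Heisenberg group over `R` with coordinates
`(e, f, g)`. -/
@[ext]
structure CoverGroup (R : Type*) where
  a : R
  b : R
  c : R
  d : R
  e : R
  f : R
  g : R

namespace CoverGroup

variable {R : Type*} [CommRing R]

instance : Mul (CoverGroup R) where
  mul x y := ⟨x.a + y.a, x.b + y.b, x.c + y.c + x.a * y.b,
    x.d + y.d + 2 * x.a * y.c + x.a ^ 2 * y.b, x.e + y.e, x.f + y.f, x.g + y.g + x.e * y.f⟩

instance : One (CoverGroup R) := ⟨⟨0, 0, 0, 0, 0, 0, 0⟩⟩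

instance : Inv (CoverGroup R) where
  inv x := ⟨-x.a, -x.b, -x.c + x.a * x.b, -x.d + 2 * x.a * x.c - x.a ^ 2 * x.b, -x.e, -x.f,
    -x.g + x.e * x.f⟩

theorem mul_def (x y : CoverGroup R) : x * y = ⟨x.a + y.a, x.b + y.b, x.c + y.c + x.a * y.b,
    x.d + y.d + 2 * x.a * y.c + x.a ^ 2 * y.b, x.e + y.e, x.f + y.f, x.g + y.g + x.e * y.f⟩ := rfl

theorem one_def : (1 : CoverGroup R) = ⟨0, 0, 0, 0, 0, 0, 0⟩ := rfl

theorem inv_def (x : CoverGroup R) : x⁻¹ = ⟨-x.a, -x.b, -x.c + x.a * x.b,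
    -x.d + 2 * x.a * x.c - x.a ^ 2 * x.b, -x.e, -x.f, -x.g + x.e * x.f⟩ := rfl

instance : Group (CoverGroup R) :=
  Group.ofLeftAxioms
    (fun x y z => by simp only [mul_def]; ext <;> ring)
    (fun x => by simp only [mul_def, one_def]; ext <;> ring)
    (fun x => by simp only [mul_def, one_def, inv_def]; ext <;> ring)

/-- Commuting with the unit vector in direction `a` forces `b = 0` and `2 * c + b = 0`; cancelling
the 2 is where odd `p` is needed. -/
theorem mem_center_iff_coords [IsDomain R] (h2 : (2 : R) ≠ 0) (x : CoverGroup R) :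
    x ∈ center (CoverGroup R) ↔ x.a = 0 ∧ x.b = 0 ∧ x.c = 0 ∧ x.e = 0 ∧ x.f = 0 := by
  rw [mem_center_iff]
  constructor
  · intro h
    have h1 := h ⟨1, 0, 0, 0, 0, 0, 0⟩
    have h2' := h ⟨0, 1, 0, 0, 0, 0, 0⟩
    have h3 := h ⟨0, 0, 0, 0, 1, 0, 0⟩
    have h4 := h ⟨0, 0, 0, 0, 0, 1, 0⟩
    simp only [mul_def, CoverGroup.mk.injEq] at h1 h2' h3 h4
    have hb : x.b = 0 := by linear_combination h1.2.2.1
    have ha : x.a = 0 := by linear_combination -h2'.2.2.1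
    have hc : x.c = 0 := by
      have : 2 * x.c = 0 := by linear_combination h1.2.2.2.1 - hb
      exact (mul_eq_zero.1 this).resolve_left h2
    have hf : x.f = 0 := by linear_combination h3.2.2.2.2.2.2
    have he : x.e = 0 := by linear_combination -h4.2.2.2.2.2.2
    exact ⟨ha, hb, hc, he, hf⟩
  · rintro ⟨ha, hb, hc, he, hf⟩ y
    simp only [mul_def, ha, hb, hc, he, hf]
    ext <;> ring

end CoverGroup

/-- A group is capable if it is the image of some group, possibly in a different universe, under a
homomorphism whose kernel is the center. -/
theorem isCapable_of_surjective {K : Type} [Group K] {G : Type u} [Group G] (f : K →* G)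
    (hf : Function.Surjective f) (hker : f.ker = center K) : IsCapable G := by
  let F : ULift.{u} K →* G := f.comp MulEquiv.ulift.toMonoidHom
  have hF : Function.Surjective F := hf.comp MulEquiv.ulift.surjective
  have hFker : F.ker = center (ULift.{u} K) := by
    ext k
    have : F k = 1 ↔ k.down ∈ center K := by rw [← hker]; rfl
    rw [MonoidHom.mem_ker, this, mem_center_iff, mem_center_iff]
    exact ⟨fun h g => congrArg ULift.up (h g.down), fun h g => congrArg ULift.down (h ⟨g⟩)⟩
  exact ⟨ULift.{u} K, inferInstance, ⟨(QuotientGroup.quotientKerEquivOfSurjective F hF).symm.trans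
    (QuotientGroup.quotientMulEquivOfEq hFker)⟩⟩

end Cover

/-! ### Exponents modulo `p` -/

section ModularPowers

variable {G : Type*} [Group G] {p : ℕ}

theorem pow_val_add [NeZero p] {g : G} (hg : g ^ p = 1) (m n : ZMod p) :
    g ^ (m + n).val = g ^ m.val * g ^ n.val := by
  rw [← pow_add, ZMod.val_add, ← pow_mod_orderOf g ((m.val + n.val) % p),
    Nat.mod_mod_of_dvd _ (orderOf_dvd_of_pow_eq_one hg), pow_mod_orderOf]

theorem pow_val_mul {g : G} (hg : g ^ p = 1) (m n : ZMod p) :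
    g ^ (m * n).val = (g ^ m.val) ^ n.val := by
  rw [← pow_mul, ZMod.val_mul, ← pow_mod_orderOf g ((m.val * n.val) % p),
    Nat.mod_mod_of_dvd _ (orderOf_dvd_of_pow_eq_one hg), pow_mod_orderOf]

theorem pow_val_eq_one_iff [Fact p.Prime] {g : G} (hg : g ^ p = 1) (h1 : g ≠ 1) (m : ZMod p) :
    g ^ m.val = 1 ↔ m = 0 := by
  rw [← orderOf_dvd_iff_pow_eq_one, orderOf_eq_prime hg h1, ← ZMod.natCast_eq_zero_iff,
    ZMod.natCast_zmod_val]

/-- A subgroup containing a power of `g` with nonzero exponent modulo `p` contains `g`. -/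
theorem mem_of_pow_val_mem [Fact p.Prime] {g : G} (hg : g ^ p = 1) {H : Subgroup G} {m : ZMod p}
    (hm : m ≠ 0) (h : g ^ m.val ∈ H) : g ∈ H := by
  have := pow_mem h (m⁻¹).val
  rw [← pow_val_mul hg, mul_inv_cancel₀ hm, ZMod.val_one, pow_one] at this
  exact this

end ModularPowers

/-! ### The map from the covering group -/

section Parametrization

variable {G : Type*} [Group G]

/-- Moving `x ^ m` past `y ^ n` produces `z ^ (m * n)`, matching the term `x.a * y.b` in the product
of `CoverGroup`. -/
theorem pow_mul_pow_of_commutator {x y z : G} (hxy : x * y = y * z * x)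
    (hz : z ∈ center G) (m n : ℕ) : x ^ m * y ^ n = y ^ n * (z ^ m) ^ n * x ^ m := by
  have cz : ∀ g, Commute g z := mem_center_iff.1 hz
  have h1 : SemiconjBy (x ^ m) y (y * z ^ m) := by
    induction m with
    | zero => simp
    | succ m ih =>
      have h : SemiconjBy x (y * z ^ m) (y * z * z ^ m) :=
        SemiconjBy.mul_right hxy ((cz x).pow_right m)
      have := h.mul_left ih
      rwa [← pow_succ', mul_assoc y z, ← pow_succ'] at this
  have h2 := (h1.pow_right n).eq
  rwa [((cz y).pow_right m).mul_pow] at h2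

/-- The homomorphism from the covering group determined by a noncommuting pair `x`, `y` with
commutator `z`, a central element `u` and an element `v` commuting with the others. -/
def coverHom {p : ℕ} [NeZero p] (hexp : ∀ g : G, g ^ p = 1) {x y z u v : G}
    (hxy : x * y = y * z * x) (hz : z ∈ center G) (hu : u ∈ center G)
    (hvx : Commute v x) (hvy : Commute v y) : CoverGroup (ZMod p) →* G where
  toFun k := y ^ k.b.val * v ^ k.f.val * x ^ k.a.val * (z ^ k.c.val * u ^ k.e.val)
  map_one' := by simp [CoverGroup.one_def]
  map_mul' k l := by
    have hw : ∀ m n : ℕ, ∀ g, Commute g (z ^ m * u ^ n) := fun m n =>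
      mem_center_iff.1 (mul_mem (pow_mem hz m) (pow_mem hu n))
    have hW : ∀ g, Commute g (z ^ (k.a * l.b).val) := mem_center_iff.1 (pow_mem hz _)
    have hzu : Commute (z ^ l.c.val) (u ^ k.e.val) := (mem_center_iff.1 (pow_mem hu _) _)
    have hX : x ^ k.a.val * y ^ l.b.val = y ^ l.b.val * z ^ (k.a * l.b).val * x ^ k.a.val := by
      rw [pow_val_mul (hexp z), pow_mul_pow_of_commutator hxy hz]
    have hc : z ^ (k.c + l.c + k.a * l.b).val * u ^ (k.e + l.e).val =
        z ^ (k.a * l.b).val * ((z ^ k.c.val * u ^ k.e.val) * (z ^ l.c.val * u ^ l.e.val)) := by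
      rw [pow_val_add (hexp z), pow_val_add (hexp z), pow_val_add (hexp u),
        ((Commute.refl z).pow_pow _ _).mul_left ((Commute.refl z).pow_pow _ _) |>.eq]
      simp only [mul_assoc]
      rw [← mul_assoc (z ^ l.c.val), hzu.eq]
      simp only [mul_assoc]
    have hl := fun g => (hw k.c.val k.e.val g).eq
    simp only [CoverGroup.mul_def]
    rw [hc, pow_val_add (hexp y), pow_val_add (hexp v), pow_val_add (hexp x)]
    generalize z ^ k.c.val * u ^ k.e.val = w at *
    generalize z ^ l.c.val * u ^ l.e.val = w' at *
    generalize z ^ (k.a * l.b).val = W at *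
    have e1 := (hvy.pow_pow k.f.val l.b.val).eq
    have e2 := (hvx.pow_pow l.f.val k.a.val).eq
    generalize v ^ k.f.val = V at *
    generalize v ^ l.f.val = V' at *
    generalize x ^ k.a.val = X at *
    generalize x ^ l.a.val = X' at *
    generalize y ^ k.b.val = Y at *
    generalize y ^ l.b.val = Y' at *
    calc Y * Y' * (V * V') * (X * X') * (W * (w * w'))
        = Y * Y' * V * (V' * X) * (X' * W) * w * w' := by simp only [mul_assoc]
      _ = Y * Y' * V * (X * V') * (W * X') * w * w' := by rw [e2, (hW X').eq]
      _ = Y * (Y' * V) * X * (V' * W) * X' * w * w' := by simp only [mul_assoc]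
      _ = Y * (V * Y') * X * (W * V') * X' * w * w' := by rw [e1, (hW V').eq]
      _ = Y * V * Y' * (X * W) * V' * X' * w * w' := by simp only [mul_assoc]
      _ = Y * V * Y' * (W * X) * V' * X' * w * w' := by rw [(hW X).eq]
      _ = Y * V * (Y' * W * X) * (V' * X' * w) * w' := by simp only [mul_assoc]
      _ = Y * V * (Y' * W * X) * (V' * X') * w * w' := by simp only [mul_assoc]
      _ = Y * V * (X * Y') * (V' * X') * w * w' := by rw [hX]
      _ = Y * V * X * (Y' * V' * X' * w) * w' := by simp only [mul_assoc]
      _ = Y * V * X * (w * (Y' * V' * X')) * w' := by rw [hl]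
      _ = Y * V * X * w * (Y' * V' * X' * w') := by simp only [mul_assoc]

end Parametrization

/-! ### Capability when the center is larger than the derived subgroup -/

/-- A group of order `p ^ 5` and odd exponent `p`, with derived subgroup of order `p` properly
contained in the center, is capable. -/
theorem isCapable_of_commutator_lt_center {G : Type u} [Group G] {p : ℕ} (hp : p.Prime)
    (hodd : Odd p) (hG : Nat.card G = p ^ 5) (hexp : ∀ g : G, g ^ p = 1)
    (hlt : commutator G < center G) (hC : Nat.card (commutator G) = p) : IsCapable G := by
  classical
  have : Fact p.Prime := ⟨hp⟩
  have : Finite G := Nat.finite_of_card_ne_zero (by rw [hG]; exact (pow_pos hp.pos _).ne')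
  have hle := hlt.le
  have hmem : ∀ a b : G, ⁅a, b⁆ ∈ commutator G := fun a b =>
    commutator_mem_commutator (mem_top a) (mem_top b)
  obtain ⟨x, y, hxy⟩ : ∃ x y : G, ⁅x, y⁆ ≠ 1 := by
    by_contra! h
    have : commutator G = ⊥ := commutator_eq_bot_iff_le_centralizer.2 fun a _ =>
      mem_centralizer_iff.2 fun b _ => commutatorElement_eq_one_iff_mul_comm.1 (h b a)
    rw [this, card_bot] at hC
    exact hp.one_lt.ne hC
  -- This form of the commutator gives `x * y = y * z * x`, with no sign in the collection formula.
  set z := y⁻¹ * x * y * x⁻¹ with hzdef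
  have hxyz : x * y = y * z * x := by rw [hzdef]; group
  have hzC : z ∈ commutator G := by
    have := hmem y⁻¹ x
    rwa [commutatorElement_def, inv_inv] at this
  have hz1 : z ≠ 1 := fun h => hxy <| commutatorElement_eq_one_iff_mul_comm.2 <| by
    rw [hxyz, h, mul_one]
  have hz := hle hzC
  have hzpow : ∀ c ∈ commutator G, c ∈ zpowers z := fun c hc => by
    obtain ⟨n, hn⟩ := mem_zpowers_iff.1 (mem_zpowers_of_prime_card hC
      (g := ⟨z, hzC⟩) (g' := ⟨c, hc⟩) fun h => hz1 (congrArg Subtype.val h))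
    exact mem_zpowers_iff.2 ⟨n, by simpa using congrArg Subtype.val hn⟩
  obtain ⟨u, hu, huC⟩ := SetLike.exists_of_lt hlt
  have huz : u ∉ zpowers z := fun h => huC ((zpowers_le.2 hzC) h)
  let T : Subgroup G := zpowers z ⊔ zpowers u
  have hTcard : Nat.card T ≤ p ^ 2 := by
    have hn : (zpowers u).Normal := ⟨fun n hn g => by
      rwa [mem_center_iff.1 ((zpowers_le.2 hu) hn) g, mul_inv_cancel_right]⟩
    have h1 : ∀ g : G, Nat.card (zpowers g) ≤ p := fun g => by
      rw [Nat.card_zpowers]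
      exact Nat.le_of_dvd hp.pos (orderOf_dvd_of_pow_eq_one (hexp g))
    have h2 : Nat.card T ≤ Nat.card (zpowers z) * Nat.card (zpowers u) := by
      rw [← Nat.card_prod]
      refine Nat.card_le_card_of_surjective
        (fun q : zpowers z × zpowers u => (⟨q.1 * q.2, mul_mem_sup q.1.2 q.2.2⟩ : T)) ?_
      rintro ⟨t, ht⟩
      obtain ⟨a, ha, b, hb, rfl⟩ := mem_sup_of_normal_right.1 ht
      exact ⟨⟨⟨a, ha⟩, ⟨b, hb⟩⟩, rfl⟩
    exact h2.trans (by rw [sq]; exact Nat.mul_le_mul (h1 z) (h1 u))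
  let D : Subgroup G := (commutatorHom hle x).ker ⊓ (commutatorHom hle y).ker
  have hD : p ^ 3 ≤ Nat.card D := by
    have := card_le_card_ker_inf_ker_mul hle x y
    rw [hG, hC, show 5 = 3 + 2 from rfl, pow_add] at this
    exact Nat.le_of_mul_le_mul_right this (pow_pos hp.pos 2)
  -- The joint centralizer of `x` and `y` has at least `p ^ 3` elements, `T` at most `p ^ 2`.
  obtain ⟨v, hvD, hvT⟩ : ∃ v ∈ D, v ∉ T := by
    by_contra! h
    have h1 := hD.trans ((card_le_of_le (K := T) h).trans hTcard)
    exact absurd ((Nat.pow_le_pow_iff_right hp.one_lt).1 h1) (by norm_num)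
  have hvx : Commute v x := (mem_ker_commutatorHom hle).1 hvD.1
  have hvy : Commute v y := (mem_ker_commutatorHom hle).1 hvD.2
  have hone : ∀ k : CoverGroup (ZMod p), coverHom hexp hxyz hz hu hvx hvy k = 1 ↔
      k.a = 0 ∧ k.b = 0 ∧ k.c = 0 ∧ k.e = 0 ∧ k.f = 0 := by
    intro k
    change y ^ k.b.val * v ^ k.f.val * x ^ k.a.val * (z ^ k.c.val * u ^ k.e.val) = 1 ↔ _
    constructor
    · intro h
      have hw : z ^ k.c.val * u ^ k.e.val ∈ center G := mul_mem (pow_mem hz _) (pow_mem hu _)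
      have hwT : z ^ k.c.val * u ^ k.e.val ∈ T :=
        mul_mem_sup (pow_mem (mem_zpowers z) _) (pow_mem (mem_zpowers u) _)
      have hcent : y ^ k.b.val * v ^ k.f.val * x ^ k.a.val ∈ center G := by
        rw [eq_inv_of_mul_eq_one_left h]
        exact inv_mem hw
      -- Both `y` and `v` commute with `y`, so centrality of the product forces the power of `x` to
      -- commute with `y`; testing against `x` then handles `k.b`.
      have ha : k.a = 0 := by
        rw [← pow_val_eq_one_iff (hexp z) hz1]
        have h1 : Commute (x ^ k.a.val) y := by
          have h2 : Commute (y ^ k.b.val * v ^ k.f.val) y :=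
            ((Commute.refl y).pow_left _).mul_left (hvy.pow_left _)
          have h3 : Commute (y ^ k.b.val * v ^ k.f.val * x ^ k.a.val) y :=
            ((mem_center_iff.1 hcent y) : _).symm
          have := h2.inv_left.mul_left h3
          rwa [inv_mul_cancel_left] at this
        have h4 := pow_mul_pow_of_commutator hxyz hz k.a.val 1
        rw [pow_one, pow_one, h1.eq] at h4
        have h5 := mul_right_cancel h4
        exact (mul_eq_left.1 h5.symm)
      have hb : k.b = 0 := by
        rw [← pow_val_eq_one_iff (hexp z) hz1]
        rw [ha, ZMod.val_zero, pow_zero, mul_one] at hcent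
        have h1 : Commute (y ^ k.b.val) x := by
          have h3 : Commute (y ^ k.b.val * v ^ k.f.val) x :=
            ((mem_center_iff.1 hcent x) : _).symm
          have := h3.mul_left (hvx.pow_left k.f.val).inv_left
          rwa [mul_inv_cancel_right] at this
        have h4 := pow_mul_pow_of_commutator hxyz hz 1 k.b.val
        rw [pow_one, pow_one, ← h1.eq] at h4
        have h5 := mul_right_cancel h4
        exact (mul_eq_left.1 h5.symm)
      rw [ha, hb, ZMod.val_zero, pow_zero, pow_zero, one_mul, mul_one] at h
      have hf : k.f = 0 := by
        by_contra hf
        refine hvT (mem_of_pow_val_mem (hexp v) hf ?_)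
        rw [eq_inv_of_mul_eq_one_left h]
        exact inv_mem hwT
      rw [hf, ZMod.val_zero, pow_zero, one_mul] at h
      have he : k.e = 0 := by
        by_contra he
        refine huz (mem_of_pow_val_mem (hexp u) he ?_)
        rw [eq_inv_of_mul_eq_one_right h]
        exact inv_mem (pow_mem (mem_zpowers z) _)
      rw [he, ZMod.val_zero, pow_zero, mul_one, pow_val_eq_one_iff (hexp z) hz1] at h
      exact ⟨ha, hb, h, he, hf⟩
    · rintro ⟨ha, hb, hc, he, hf⟩
      simp [ha, hb, hc, he, hf]
  have h2 : (2 : ZMod p) ≠ 0 := by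
    have : ¬ p ∣ 2 := fun h => by
      have := (Nat.prime_dvd_prime_iff_eq hp Nat.prime_two).1 h
      subst this
      exact absurd hodd (by decide)
    rw [← ZMod.natCast_eq_zero_iff] at this
    exact_mod_cast this
  have hker : (coverHom hexp hxyz hz hu hvx hvy).ker = center (CoverGroup (ZMod p)) := by
    ext k
    rw [MonoidHom.mem_ker, hone, CoverGroup.mem_center_iff_coords h2]
  refine isCapable_of_surjective (coverHom hexp hxyz hz hu hvx hvy) ?_ hker
  -- Setting the central coordinates `d` and `g` to 0 picks one representative per coset of the
  -- center; these number `p ^ 5`, so injectivity on them yields surjectivity.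
  let s : ZMod p × ZMod p × ZMod p × ZMod p × ZMod p → CoverGroup (ZMod p) :=
    fun q => ⟨q.1, q.2.1, q.2.2.1, 0, q.2.2.2.1, q.2.2.2.2, 0⟩
  have hinj : Function.Injective (coverHom hexp hxyz hz hu hvx hvy ∘ s) := by
    intro q r hqr
    have h1 : coverHom hexp hxyz hz hu hvx hvy ((s r)⁻¹ * s q) = 1 := by
      rw [map_mul, map_inv, inv_mul_eq_one]
      exact hqr.symm
    rw [hone] at h1
    simp only [CoverGroup.mul_def, CoverGroup.inv_def, s] at h1
    obtain ⟨ha, hb, hc, he, hf⟩ := h1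
    have ha' : q.1 = r.1 := by linear_combination ha
    have hb' : q.2.1 = r.2.1 := by linear_combination hb
    have hc' : q.2.2.1 = r.2.2.1 := by linear_combination hc + r.1 * hb
    have he' : q.2.2.2.1 = r.2.2.2.1 := by linear_combination he
    have hf' : q.2.2.2.2 = r.2.2.2.2 := by linear_combination hf
    exact Prod.ext ha' (Prod.ext hb' (Prod.ext hc' (Prod.ext he' hf')))
  have hbij : Function.Bijective (coverHom hexp hxyz hz hu hvx hvy ∘ s) := by
    refine (Nat.bijective_iff_injective_and_card _).2 ⟨hinj, ?_⟩
    simp only [Nat.card_prod, Nat.card_zmod, hG]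
    ring
  exact hbij.surjective.of_comp

/-! ### Translating the hypotheses and conclusion -/

theorem commutator_le_center_of_nilpotencyClass_eq_two {G : Type*} [Group G]
    (h : Group.nilpotencyClass G = 2) : commutator G ≤ center G := by
  have hnil : Group.IsNilpotent G := by
    by_contra hn
    rw [Group.nilpotencyClass_of_not_nilpotent hn] at h
    exact absurd h (by norm_num)
  have h1 : Subgroup.upperCentralSeries G 2 = ⊤ :=
    Subgroup.upperCentralSeries_eq_top_iff_nilpotencyClass_le.2 h.le
  rw [commutator_def, commutator_le]
  intro a _ b _
  have ha : a ∈ Subgroup.upperCentralSeries G 2 := h1 ▸ mem_top a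
  rw [Subgroup.mem_upperCentralSeries_succ_iff] at ha
  simpa [Subgroup.upperCentralSeries_one] using ha b

theorem mainTheorem11 {p : ℕ} (hp : p.Prime) (hp_odd : Odd p)
    (G : Type u) [Group G]
    (hclass : Group.nilpotencyClass G = 2)
    (hexp : Monoid.exponent G = p)
    [Group.FG (Abelianization G)] [Group.FG (commutator G)]
    (hab : Group.rank (Abelianization G) = 4)
    (hcomm : Group.rank (commutator G) = 1) :
    (IsCapable G ↔
      Nontrivial (Subgroup.center G ⧸ (commutator G).subgroupOf (Subgroup.center G))) ∧
    (IsCapable G ↔ ¬ IsExtraSpecial p G) := by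
  have hle := commutator_le_center_of_nilpotencyClass_eq_two hclass
  have hpow : ∀ g : G, g ^ p = 1 := fun g => hexp ▸ Monoid.pow_exponent_eq_one g
  have hcardAb : Nat.card (Abelianization G) = p ^ 4 := by
    rw [card_eq_pow_rank_of_elementary hp (Abelianization G), hab]
    intro x
    obtain ⟨g, rfl⟩ := QuotientGroup.mk_surjective x
    exact congrArg QuotientGroup.mk (hpow g)
  have hC : Nat.card (commutator G) = p := by
    let _ : CommGroup (commutator G) :=
      { (inferInstance : Group (commutator G)) with
        mul_comm := fun a b => Subtype.ext (mem_center_iff.1 (hle b.2) a) }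
    have := card_eq_pow_rank_of_elementary hp (commutator G) fun x => Subtype.ext (hpow x)
    rw [this]
    exact (congrArg (p ^ ·) hcomm).trans (pow_one p)
  have hG : Nat.card G = p ^ 5 := by
    rw [(commutator G).card_eq_card_quotient_mul_card_subgroup, hC, pow_succ]
    exact congrArg (· * p) hcardAb
  have : Finite G := Nat.finite_of_card_ne_zero (by rw [hG]; exact (pow_pos hp.pos _).ne')
  have hextra : IsExtraSpecial p G ↔ commutator G = center G := by
    constructor
    · intro h
      exact eq_of_le_of_card_ge hle (by rw [h.card_center, hC])
    · intro h
      refine ⟨inferInstance, h ▸ hC, ?_, ?_, ?_⟩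
      · rw [QuotientGroup.nontrivial_iff]
        intro ht
        rw [h, ht, card_top, hG] at hC
        have := Nat.pow_lt_pow_right hp.one_lt (show 1 < 5 by norm_num)
        rw [hC, pow_one] at this
        exact this.false
      · rintro ⟨a⟩ ⟨b⟩
        refine (commutatorElement_eq_one_iff_mul_comm (g₁ := (a : G ⧸ center G)) (g₂ := b)).1 ?_
        exact (QuotientGroup.eq_one_iff ⁅a, b⁆).2
          (hle (commutator_mem_commutator (mem_top a) (mem_top b)))
      · rintro ⟨a⟩
        exact congrArg QuotientGroup.mk (hpow a)
  have hnontriv : Nontrivial (center G ⧸ (commutator G).subgroupOf (center G)) ↔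
      ¬ commutator G = center G := by
    rw [QuotientGroup.nontrivial_iff, Ne, subgroupOf_eq_top]
    exact not_congr ⟨fun h => le_antisymm hle h, fun h => h.ge⟩
  have hcap : IsCapable G ↔ ¬ commutator G = center G := by
    constructor
    · intro h heq
      exact not_isCapable_of_centralizers_nonabelian hp hC
        (exists_noncommuting_in_centralizer hp hG hle hC (heq ▸ hC)) h
    · intro h
      exact isCapable_of_commutator_lt_center hp hp_odd hG hpow (lt_of_le_of_ne hle h) hC
  exact ⟨hcap.trans hnontriv.symm, hcap.trans (not_congr hextra).symm⟩
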